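/- For an integer $k$ and a real $\alpha>\frac k2$, let $\mathfrak m_{k,\alpha}$ denote the Cauchy probability measure of order $\alpha$ on $\mathbb R^k$, i.e. the measure with density $$\frac{1}{c_{k,\alpha}}\,(1+|x|^2)^{-\alpha},\qquad c_{k,\alpha}=\int_{\mathbb R^k}(1+|x|^2)^{-\alpha}\,dx,$$ with respect to Lebesgue measure, where $|\cdot|$ is the Euclidean norm. For a Borel probability measure $\nu$ on $\mathbb R^n$ and a Borel set $A\subseteq\mathbb R^n$, let $$\nu^+(A)=\liminf_{\varepsilon\to0^+}\frac{\nu(A_\varepsilon)-\nu(A)}{\varepsilon}\in[0,\infty]$$ be the $\nu$-perimeter (outer Minkowski content) of $A$, where $A_\varepsilon$ is the open $\varepsilon$-neighborhood of $A$ for the Euclidean distance. Let $n$ be a dimension, let $\alpha\ge n+1$ be real and let $\beta=\alpha-\frac{n+1}{2}$. Then for every closed set $A\subseteq\mathbb R^n$, with complement $A^c=\mathbb R^n\setminus A$, $$\mathfrak m_{n,\beta}^+(A)\;\ge\;\frac{2\sqrt{\alpha-n}}{\sqrt\pi}\;\mathfrak m_{2n,\alpha}(A\times A^c),$$ where $\mathbb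 R^n\times\mathbb R^n$ is identified with $\mathbb R^{2n}$, with $|(x,y)|^2=|x|^2+|y|^2$. -/

import Mathlib

open MeasureTheory Filter Topology

noncomputable section

/-- The normalizing constant `c = ∫ (1 + |x|²)^(-α) dx` of the Cauchy measure of order `α` on the
Euclidean space `E`; the integral is finite exactly when `α > dim E / 2`. -/
def cauchyNormConst (E : Type*) [NormedAddCommGroup E] [InnerProductSpace ℝ E]
    [FiniteDimensional ℝ E] [MeasurableSpace E] [BorelSpace E] (α : ℝ) : ℝ :=
  ∫ x : E, (1 + ‖x‖ ^ 2) ^ (-α)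

/-- The Cauchy measure of order `α` on the Euclidean space `E`: the measure with density
`c⁻¹ (1 + |x|²)^(-α)` with respect to Lebesgue measure. It is a probability measure for
`α > dim E / 2`, the only orders for which it is used. -/
def multivariateCauchy (E : Type*) [NormedAddCommGroup E] [InnerProductSpace ℝ E]
    [FiniteDimensional ℝ E] [MeasurableSpace E] [BorelSpace E] (α : ℝ) : Measure E :=
  volume.withDensity fun x : E =>
    ENNReal.ofReal ((cauchyNormConst E α)⁻¹ * (1 + ‖x‖ ^ 2) ^ (-α))

/-- The `ν`-perimeter (outer Minkowski content) of `A`, with values in `[0, ∞]`: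
`liminf_{ε → 0⁺} (ν(A_ε) - ν(A)) / ε`, where `A_ε` is the open `ε`-neighborhood of `A`.
For a finite measure `ν` the truncated subtraction is the true one, since `A ⊆ A_ε`. -/
def outerMinkowskiContent {E : Type*} [PseudoEMetricSpace E] [MeasurableSpace E]
    (ν : Measure E) (A : Set E) : ENNReal :=
  liminf (fun ε : ℝ => (ν (Metric.thickening ε A) - ν A) / ENNReal.ofReal ε) (𝓝[>] 0)

end

noncomputable section

open scoped ENNReal NNReal

/-! The Cauchy measure on `E × E` is rotation invariant, so Pisier's rotation argument applies to
it. A quarter turn replaces `x` by `y`; cut into `N` equal rotations, it moves a Lipschitz `f` by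
increments that all have the same L¹ norm. Letting `N → ∞` bounds the mean of `|f y - f x|` by `π/2`
times the mean of `|Df(x) y|` (`lintegral_enorm_sub_le_lintegral_fderiv`).

For fixed `x` the integral over `y` is explicit, because a Cauchy density is a mixture of Gaussians.
It leaves `‖Df(x)‖` integrated against the Cauchy measure of order `β` on `E`, times a ratio of
Gamma values (`lintegral_fderiv_multivariateCauchy_eq`), which log-convexity of Gamma controls when
`α - n ≥ 1`.

Take for `f` the cutoff equal to 1 on `A` and 0 off `A_ε`. The left side is at least twice the mass
of `A × (A_ε)ᶜ`, and the gradient term is at most the mass of the shell `A_ε \ A` over `ε`. Since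
`A` is closed, `ε → 0` gives the theorem. -/

/-! ### Gradient of the Lipschitz cutoff. -/

/-- Off the shell the cutoff attains its global maximum 1 or minimum 0, so Fermat's rule applies
even at boundary points of `A`. -/
theorem fderiv_thickenedIndicator_eq_zero {E : Type*} [NormedAddCommGroup E]
    [NormedSpace ℝ E]
    {ε : ℝ} (hε : 0 < ε) (A : Set E) {x : E} (hx : x ∉ Metric.thickening ε A \ A) :
    fderiv ℝ (fun y => (thickenedIndicator hε A y : ℝ)) x = 0 := by
  by_cases hxA : x ∈ A
  · refine IsLocalMax.fderiv_eq_zero (.of_forall fun y => ?_)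
    simpa [thickenedIndicator_one hε A hxA] using thickenedIndicator_le_one hε A y
  · refine IsLocalMin.fderiv_eq_zero (.of_forall fun y => ?_)
    simp [thickenedIndicator_zero hε A fun h => hx ⟨h, hxA⟩]

theorem lintegral_fderiv_thickenedIndicator_le {E : Type*} [NormedAddCommGroup E]
    [InnerProductSpace ℝ E] [MeasurableSpace E] [BorelSpace E] (μ : Measure E) {ε : ℝ} (hε : 0 < ε) {A : Set E}
    (hA : MeasurableSet A) :
    ∫⁻ x, ‖fderiv ℝ (fun y => (thickenedIndicator hε A y : ℝ)) x‖ₑ ∂μ ≤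
      μ (Metric.thickening ε A \ A) / ENNReal.ofReal ε := by
  have hL : LipschitzWith ε.toNNReal⁻¹ (fun y => (thickenedIndicator hε A y : ℝ)) :=
    lipschitzWith_thickenedIndicator hε A
  rw [div_eq_mul_inv, mul_comm, ← lintegral_indicator_const
    (Metric.isOpen_thickening.measurableSet.diff hA)]
  refine lintegral_mono fun x => ?_
  by_cases hx : x ∈ Metric.thickening ε A \ A
  · rw [Set.indicator_of_mem hx, ENNReal.ofReal, ← ENNReal.coe_inv (by simpa using hε)]
    exact ENNReal.coe_le_coe.2 (norm_fderiv_le_of_lipschitz ℝ hL)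
  · rw [fderiv_thickenedIndicator_eq_zero hε A hx, ← ofReal_norm, norm_zero, ENNReal.ofReal_zero]
    exact zero_le

/-! ### Cauchy integrals as mixtures of Gaussian integrals. -/

theorem ofReal_rpow_neg_eq_lintegral {r s : ℝ} (hr : 0 < r) (hs : 0 < s) :
    ENNReal.ofReal (r ^ (-s)) = ENNReal.ofReal (Real.Gamma s)⁻¹ *
      ∫⁻ t in Set.Ioi (0 : ℝ), ENNReal.ofReal (t ^ (s - 1) * Real.exp (-(r * t))) := by
  have hΓ := Real.Gamma_pos_of_pos hs
  have h := Real.integral_rpow_mul_exp_neg_mul_Ioi hs hr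
  have hint : Integrable (fun t : ℝ => t ^ (s - 1) * Real.exp (-(r * t)))
      (volume.restrict (Set.Ioi 0)) := by
    -- A non-integrable function would have integral 0 by convention, whereas the Gamma formula
    -- gives a positive value.
    by_contra hn
    rw [integral_undef hn] at h
    have : 0 < (1 / r) ^ s * Real.Gamma s := by positivity
    linarith
  rw [← ofReal_integral_eq_lintegral_ofReal hint, h, ← ENNReal.ofReal_mul (by positivity)]
  · congr 1
    rw [Real.rpow_neg hr.le, one_div, Real.inv_rpow hr.le]
    field_simp
  · filter_upwards [ae_restrict_mem measurableSet_Ioi] with t ht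
    have : 0 < t := ht
    positivity

section

variable {E : Type*} [NormedAddCommGroup E] [InnerProductSpace ℝ E]
    [FiniteDimensional ℝ E] [MeasurableSpace E] [BorelSpace E]

/-- Write the power as a Gamma integral over `t` and exchange integrals. The Gaussian integral in
`y` contributes `t ^ (-s)`, so the remaining `t`-integral is again a Gamma integral, with `a`
lowered to `a - s`. -/
theorem lintegral_mul_rpow_neg_add_norm_sq {g : E → ℝ≥0∞} (hg : Measurable g) {G : ℝ≥0∞} {s : ℝ}
    (hG : ∀ t : ℝ, 0 < t → ∫⁻ y, g y * ENNReal.ofReal (Real.exp (-t * ‖y‖ ^ 2))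
      = G * ENNReal.ofReal (t ^ (-s)))
    {a r : ℝ} (ha : 0 < a) (hs : s < a) (hr : 0 < r) :
    ∫⁻ y, g y * ENNReal.ofReal ((r + ‖y‖ ^ 2) ^ (-a))
      = G * ENNReal.ofReal (Real.Gamma (a - s) / Real.Gamma a * r ^ (-(a - s))) := by
  have hΓ := Real.Gamma_pos_of_pos ha
  have hΓ' := Real.Gamma_pos_of_pos (sub_pos.2 hs)
  have h1 : ∀ y : E, g y * ENNReal.ofReal ((r + ‖y‖ ^ 2) ^ (-a)) =
      ENNReal.ofReal (Real.Gamma a)⁻¹ * ∫⁻ t in Set.Ioi (0 : ℝ),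
        g y * ENNReal.ofReal (t ^ (a - 1) * Real.exp (-((r + ‖y‖ ^ 2) * t))) := by
    intro y
    rw [ofReal_rpow_neg_eq_lintegral (by positivity) ha, lintegral_const_mul _ (by fun_prop)]
    ring
  simp_rw [h1]
  rw [lintegral_const_mul' _ _ ENNReal.ofReal_ne_top, lintegral_lintegral_swap (by fun_prop)]
  have h2 : ∀ t ∈ Set.Ioi (0 : ℝ),
      ∫⁻ y : E, g y * ENNReal.ofReal (t ^ (a - 1) * Real.exp (-((r + ‖y‖ ^ 2) * t))) =
      G * ENNReal.ofReal (t ^ (a - s - 1) * Real.exp (-(r * t))) := by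
    intro t ht
    have ht : 0 < t := ht
    have h3 : ∀ y : E, g y * ENNReal.ofReal (t ^ (a - 1) * Real.exp (-((r + ‖y‖ ^ 2) * t))) =
        ENNReal.ofReal (t ^ (a - 1) * Real.exp (-(r * t))) *
          (g y * ENNReal.ofReal (Real.exp (-t * ‖y‖ ^ 2))) := by
      intro y
      rw [mul_left_comm, ← ENNReal.ofReal_mul (by positivity), mul_assoc, ← Real.exp_add]
      ring_nf
    simp_rw [h3]
    rw [lintegral_const_mul' _ _ ENNReal.ofReal_ne_top, hG t ht, mul_left_comm,
      ← ENNReal.ofReal_mul (by positivity)]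
    congr 2
    rw [show a - s - 1 = a - 1 + -s by ring, Real.rpow_add ht]
    ring
  rw [setLIntegral_congr_fun measurableSet_Ioi h2, lintegral_const_mul _ (by fun_prop), mul_left_comm]
  congr 1
  have h4 := ofReal_rpow_neg_eq_lintegral hr (sub_pos.2 hs)
  rw [div_eq_mul_inv, mul_comm (Real.Gamma (a - s)), mul_assoc,
    ENNReal.ofReal_mul (by positivity : 0 ≤ (Real.Gamma a)⁻¹), ENNReal.ofReal_mul hΓ'.le, h4,
    ← mul_assoc (ENNReal.ofReal (Real.Gamma (a - s))), ← ENNReal.ofReal_mul hΓ'.le,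
    mul_inv_cancel₀ hΓ'.ne', ENNReal.ofReal_one, one_mul]

theorem lintegral_exp_neg_mul_norm_sq {t : ℝ} (ht : 0 < t) :
    ∫⁻ y : E, ENNReal.ofReal (Real.exp (-t * ‖y‖ ^ 2)) =
      ENNReal.ofReal (Real.pi ^ (Module.finrank ℝ E / 2 : ℝ)) *
        ENNReal.ofReal (t ^ (-(Module.finrank ℝ E / 2 : ℝ))) := by
  have h := GaussianFourier.integral_rexp_neg_mul_sq_norm (V := E) ht
  have hpos : 0 < (Real.pi / t) ^ (Module.finrank ℝ E / 2 : ℝ) := by positivity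
  rw [← ofReal_integral_eq_lintegral_ofReal (Integrable.of_integral_ne_zero (h ▸ hpos.ne'))
    (.of_forall fun y => (Real.exp_pos _).le), h, ← ENNReal.ofReal_mul (by positivity),
    Real.div_rpow Real.pi_pos.le ht.le, Real.rpow_neg ht.le, div_eq_mul_inv]

theorem integral_abs_mul_exp_neg_mul_sq {t : ℝ} (ht : 0 < t) :
    ∫ x : ℝ, |x| * Real.exp (-t * x ^ 2) = t⁻¹ := by
  have h1 : ∀ x : ℝ, |x| * Real.exp (-t * x ^ 2) =
      (fun y : ℝ => y * Real.exp (-t * y ^ 2)) |x| := fun x => by simp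
  simp_rw [h1]
  rw [integral_comp_abs (f := fun y : ℝ => y * Real.exp (-t * y ^ 2))]
  have := integral_rpow_mul_exp_neg_mul_rpow (p := 2) (q := 1) (b := t) (by norm_num)
    (by norm_num) ht
  norm_num at this
  simp_rw [neg_mul]
  rw [this, Real.rpow_neg_one]
  ring

theorem integral_norm_coord_mul_exp {ι : Type*} [Fintype ι] [DecidableEq ι] (i : ι) {t : ℝ}
    (ht : 0 < t) :
    ∫ y : EuclideanSpace ℝ ι, |y i| * Real.exp (-t * ‖y‖ ^ 2) =
      t⁻¹ * √(Real.pi / t) ^ (Fintype.card ι - 1) := by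
  rw [← (PiLp.volume_preserving_toLp ι).integral_comp
    (MeasurableEquiv.toLp 2 (ι → ℝ)).measurableEmbedding]
  have h : ∀ y : ι → ℝ, |(WithLp.toLp 2 y : EuclideanSpace ℝ ι) i| *
      Real.exp (-t * ‖(WithLp.toLp 2 y : EuclideanSpace ℝ ι)‖ ^ 2) =
      ∏ j, (if j = i then |y j| else 1) * Real.exp (-t * y j ^ 2) := by
    intro y
    rw [Finset.prod_mul_distrib, EuclideanSpace.norm_sq_eq, Finset.mul_sum, Real.exp_sum]
    simp
  simp_rw [h]
  rw [integral_fintype_prod_volume_eq_prod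
    (fun j (x : ℝ) => (if j = i then |x| else 1) * Real.exp (-t * x ^ 2)),
    ← Finset.mul_prod_erase _ _ (Finset.mem_univ i)]
  congr 1
  · simpa using integral_abs_mul_exp_neg_mul_sq ht
  · rw [Finset.prod_congr rfl (g := fun _ => √(Real.pi / t))]
    · simp [Finset.card_erase_of_mem]
    · intro j hj
      simpa [Finset.ne_of_mem_erase hj] using integral_gaussian t

/-- In an orthonormal basis containing the direction of `L`, the Gaussian factorizes: that
coordinate gives the absolute moment `t⁻¹`, every other one gives `√(π / t)`. -/
theorem lintegral_clm_mul_exp (L : E →L[ℝ] ℝ) {t : ℝ} (ht : 0 < t) :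
    ∫⁻ y : E, ‖L y‖ₑ * ENNReal.ofReal (Real.exp (-t * ‖y‖ ^ 2)) =
      ‖L‖ₑ * ENNReal.ofReal (Real.pi ^ (((Module.finrank ℝ E : ℝ) - 1) / 2)) *
        ENNReal.ofReal (t ^ (-(((Module.finrank ℝ E : ℝ) + 1) / 2))) := by
  rcases eq_or_ne L 0 with rfl | hL
  · have h0 : ‖(0 : E →L[ℝ] ℝ)‖ₑ = 0 := by rw [← ofReal_norm]; simp
    rw [h0, zero_mul, zero_mul]
    simp
  obtain ⟨v, rfl⟩ := (InnerProductSpace.toDual ℝ E).surjective L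
  have hv : v ≠ 0 := by rintro rfl; simp at hL
  have hvn : ‖v‖ ≠ 0 := norm_ne_zero_iff.2 hv
  set w : E := ‖v‖⁻¹ • v with hw
  have hw1 : ‖w‖ = 1 := by rw [hw, norm_smul]; simp [hvn]
  have hvw : v = ‖v‖ • w := by rw [hw, smul_smul, mul_inv_cancel₀ hvn, one_smul]
  obtain ⟨u, b, hu, hb⟩ := Orthonormal.exists_orthonormalBasis_extension (𝕜 := ℝ) (v := {w})
    (by
    refine ⟨fun x => by rw [Set.mem_singleton_iff.1 x.2]; exact hw1, fun x y hxy => ?_⟩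
    exact (hxy (Subsingleton.elim x y)).elim)
  classical
  let i : u := ⟨w, hu rfl⟩
  have hbi : b i = w := by rw [hb]
  have hcard : Fintype.card u = Module.finrank ℝ E := (Module.finrank_eq_card_basis b.toBasis).symm
  -- Makes the natural-number exponent `finrank - 1` a true subtraction.
  have hcard1 : 1 ≤ Module.finrank ℝ E := hcard ▸ Fintype.card_pos_iff.2 ⟨i⟩
  have h1 : ∫ y : E, ‖v‖ * (|(b.repr y) i| * Real.exp (-t * ‖b.repr y‖ ^ 2)) =
      ‖v‖ * (t⁻¹ * √(Real.pi / t) ^ (Module.finrank ℝ E - 1)) := by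
    rw [integral_const_mul, b.measurePreserving_repr.integral_comp
      b.repr.toMeasurableEquiv.measurableEmbedding
      (fun y : EuclideanSpace ℝ u => |y i| * Real.exp (-t * ‖y‖ ^ 2)),
      integral_norm_coord_mul_exp i ht, hcard]
  have hpos : 0 < ‖v‖ * (t⁻¹ * √(Real.pi / t) ^ (Module.finrank ℝ E - 1)) := by positivity
  have h2 : ∀ y : E, ‖InnerProductSpace.toDual ℝ E v y‖ₑ *
      ENNReal.ofReal (Real.exp (-t * ‖y‖ ^ 2)) =
      ENNReal.ofReal (‖v‖ * (|(b.repr y) i| * Real.exp (-t * ‖b.repr y‖ ^ 2))) := by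
    intro y
    rw [← ofReal_norm, ← ENNReal.ofReal_mul (norm_nonneg _), b.repr_apply_apply, hbi,
      LinearIsometryEquiv.norm_map, InnerProductSpace.toDual_apply_apply]
    conv_lhs => rw [hvw]
    rw [real_inner_smul_left, norm_mul, norm_norm, Real.norm_eq_abs, mul_assoc]
  simp_rw [h2]
  rw [← ofReal_integral_eq_lintegral_ofReal (Integrable.of_integral_ne_zero (h1 ▸ hpos.ne'))
    (.of_forall fun y => by positivity), h1, LinearIsometryEquiv.enorm_map, ← ofReal_norm,
    ENNReal.ofReal_mul (norm_nonneg v), mul_assoc,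
    ← ENNReal.ofReal_mul (Real.rpow_nonneg Real.pi_pos.le _)]
  congr 2
  rw [← Real.rpow_natCast, Nat.cast_sub hcard1, Nat.cast_one, Real.sqrt_eq_rpow,
    ← Real.rpow_mul (by positivity), Real.div_rpow Real.pi_pos.le ht.le,
    show -(((Module.finrank ℝ E : ℝ) + 1) / 2) = -1 - 1 / 2 * ((Module.finrank ℝ E : ℝ) - 1) by ring,
    Real.rpow_sub ht, Real.rpow_neg_one]
  ring_nf

theorem lintegral_rpow_neg_one_add_norm_sq {a : ℝ} (ha0 : 0 < a)
    (ha : (Module.finrank ℝ E : ℝ) / 2 < a) :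
    ∫⁻ y : E, ENNReal.ofReal ((1 + ‖y‖ ^ 2) ^ (-a)) =
      ENNReal.ofReal (Real.pi ^ (Module.finrank ℝ E / 2 : ℝ) *
        (Real.Gamma (a - Module.finrank ℝ E / 2) / Real.Gamma a)) := by
  have h := lintegral_mul_rpow_neg_add_norm_sq (E := E) (g := fun _ => 1) measurable_const
    (fun t ht => by simpa using lintegral_exp_neg_mul_norm_sq (E := E) ht) ha0 ha one_pos
  simpa [ENNReal.ofReal_mul (Real.rpow_nonneg Real.pi_pos.le _)] using h

theorem lintegral_clm_mul_rpow_neg_add_norm_sq (L : E →L[ℝ] ℝ) {a r : ℝ} (hr : 0 < r)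
    (ha : ((Module.finrank ℝ E : ℝ) + 1) / 2 < a) :
    ∫⁻ y : E, ‖L y‖ₑ * ENNReal.ofReal ((r + ‖y‖ ^ 2) ^ (-a)) =
      ‖L‖ₑ * ENNReal.ofReal (Real.pi ^ (((Module.finrank ℝ E : ℝ) - 1) / 2) *
        (Real.Gamma (a - ((Module.finrank ℝ E : ℝ) + 1) / 2) / Real.Gamma a) *
          r ^ (-(a - ((Module.finrank ℝ E : ℝ) + 1) / 2))) := by
  rw [lintegral_mul_rpow_neg_add_norm_sq (by fun_prop) (fun t ht => lintegral_clm_mul_exp L ht)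
    (lt_trans (by positivity) ha) ha hr, mul_assoc, ← ENNReal.ofReal_mul (by positivity), mul_assoc]

theorem cauchyNormConst_eq {a : ℝ} (ha0 : 0 < a) (ha : (Module.finrank ℝ E : ℝ) / 2 < a) :
    cauchyNormConst E a = Real.pi ^ (Module.finrank ℝ E / 2 : ℝ) *
        (Real.Gamma (a - Module.finrank ℝ E / 2) / Real.Gamma a) := by
  have h1 := Real.Gamma_pos_of_pos ha0
  have h2 := Real.Gamma_pos_of_pos (sub_pos.2 ha)
  rw [cauchyNormConst, integral_eq_lintegral_of_nonneg_ae (.of_forall fun y => by positivity)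
    (Measurable.aestronglyMeasurable (by fun_prop)), lintegral_rpow_neg_one_add_norm_sq ha0 ha,
    ENNReal.toReal_ofReal (by positivity)]

theorem cauchyNormConst_pos {a : ℝ} (ha0 : 0 < a) (ha : (Module.finrank ℝ E : ℝ) / 2 < a) :
    0 < cauchyNormConst E a := by
  have h1 := Real.Gamma_pos_of_pos ha0
  have h2 := Real.Gamma_pos_of_pos (sub_pos.2 ha)
  rw [cauchyNormConst_eq ha0 ha]
  positivity

theorem isProbabilityMeasure_multivariateCauchy {a : ℝ} (ha0 : 0 < a)
    (ha : (Module.finrank ℝ E : ℝ) / 2 < a) : IsProbabilityMeasure (multivariateCauchy E a) := by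
  have hc := cauchyNormConst_pos ha0 ha
  refine ⟨?_⟩
  rw [multivariateCauchy, withDensity_apply _ MeasurableSet.univ, setLIntegral_univ]
  simp_rw [ENNReal.ofReal_mul (inv_nonneg.2 hc.le)]
  rw [lintegral_const_mul' _ _ ENNReal.ofReal_ne_top, lintegral_rpow_neg_one_add_norm_sq ha0 ha,
    ← cauchyNormConst_eq ha0 ha, ← ENNReal.ofReal_mul (inv_nonneg.2 hc.le), inv_mul_cancel₀ hc.ne',
    ENNReal.ofReal_one]

end

/-! ### Bound on the Gamma ratio. -/

/-- Log-convexity at the midpoint of `a` and `a + 1` gives `(a - 1/2) Γ(a - 1/2) = Γ(a + 1/2) ≤ √a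
Γ(a)`; then `a ≤ 2 (a - 1/2)` because `a ≥ 1`. -/
theorem Gamma_sub_half_div_Gamma_le {a : ℝ} (ha : 1 ≤ a) :
    Real.Gamma (a - 1 / 2) / Real.Gamma a ≤ 2 / √a := by
  have hΓ := Real.Gamma_pos_of_pos (by linarith : 0 < a)
  have h := Real.Gamma_mul_add_mul_le_rpow_Gamma_mul_rpow_Gamma (s := a) (t := a + 1)
    (a := 1 / 2) (b := 1 / 2) (by linarith) (by linarith) (by norm_num) (by norm_num) (by norm_num)
  rw [show 1 / 2 * a + 1 / 2 * (a + 1) = (a - 1 / 2) + 1 by ring,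
    Real.Gamma_add_one (by linarith), Real.Gamma_add_one (by linarith), ← Real.sqrt_eq_rpow,
    ← Real.sqrt_eq_rpow, ← Real.sqrt_mul hΓ.le,
    show Real.Gamma a * (a * Real.Gamma a) = a * Real.Gamma a ^ 2 by ring,
    Real.sqrt_mul (by linarith), Real.sqrt_sq hΓ.le] at h
  have hs : 0 < √a := Real.sqrt_pos.2 (by linarith)
  have hs2 : √a * √a = a := Real.mul_self_sqrt (by linarith)
  have hG := Real.Gamma_pos_of_pos (by linarith : 0 < a - 1 / 2)
  rw [div_le_div_iff₀ hΓ hs]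
  have h' := mul_le_mul_of_nonneg_left h hs.le
  nlinarith [mul_nonneg hG.le (sub_nonneg.2 ha)]

/-! ### Invariance and first moment of the Cauchy measure. -/

section

variable {E : Type*} [NormedAddCommGroup E] [InnerProductSpace ℝ E]
    [FiniteDimensional ℝ E] [MeasurableSpace E] [BorelSpace E]

theorem lintegral_multivariateCauchy (a : ℝ) {g : E → ℝ≥0∞} (hg : Measurable g) :
    ∫⁻ x, g x ∂(multivariateCauchy E a) = ENNReal.ofReal (cauchyNormConst E a)⁻¹ *
      ∫⁻ x, g x * ENNReal.ofReal ((1 + ‖x‖ ^ 2) ^ (-a)) := by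
  have hc : 0 ≤ cauchyNormConst E a := integral_nonneg fun x => by positivity
  rw [multivariateCauchy, lintegral_withDensity_eq_lintegral_mul _ (by fun_prop) hg,
    ← lintegral_const_mul' _ _ ENNReal.ofReal_ne_top]
  refine lintegral_congr fun x => ?_
  rw [Pi.mul_apply, ENNReal.ofReal_mul (inv_nonneg.2 hc), mul_assoc, mul_comm (g x)]

theorem lintegral_multivariateCauchy_comp (a : ℝ) (T : E ≃ₗᵢ[ℝ] E) {g : E → ℝ≥0∞}
    (hg : Measurable g) :
    ∫⁻ x, g (T x) ∂(multivariateCauchy E a) = ∫⁻ x, g x ∂(multivariateCauchy E a) := by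
  rw [lintegral_multivariateCauchy a hg,
    lintegral_multivariateCauchy a (g := fun x => g (T x)) (hg.comp T.continuous.measurable),
    ← T.measurePreserving.lintegral_comp
      (f := fun x => g x * ENNReal.ofReal ((1 + ‖x‖ ^ 2) ^ (-a))) (by fun_prop)]
  simp

theorem lintegral_enorm_multivariateCauchy_ne_top {a : ℝ}
    (ha : (Module.finrank ℝ E : ℝ) / 2 + 1 / 2 < a) :
    ∫⁻ x, ‖x‖ₑ ∂(multivariateCauchy E a) ≠ ∞ := by
  have hd : (0 : ℝ) ≤ Module.finrank ℝ E := Nat.cast_nonneg _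
  rw [lintegral_multivariateCauchy a (by fun_prop)]
  -- Since `‖x‖ ≤ (1 + ‖x‖²)^(1/2)`, the moment is dominated by the density integral of order `a -
  -- 1/2`.
  refine ENNReal.mul_ne_top ENNReal.ofReal_ne_top (ne_top_of_le_ne_top
    (lintegral_rpow_neg_one_add_norm_sq (E := E) (a := a - 1 / 2) (by linarith) (by linarith) ▸
      ENNReal.ofReal_ne_top) (lintegral_mono fun x => ?_))
  rw [← ofReal_norm, ← ENNReal.ofReal_mul (norm_nonneg _)]
  refine ENNReal.ofReal_le_ofReal ?_
  have h1 : 0 < 1 + ‖x‖ ^ 2 := by positivity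
  rw [show -(a - 1 / 2) = 1 / 2 + -a by ring, Real.rpow_add h1, ← Real.sqrt_eq_rpow]
  gcongr
  exact Real.le_sqrt_of_sq_le (by linarith)

end

/-! ### Rotations of pairs and Pisier's inequality. -/

variable {E : Type*} [NormedAddCommGroup E] [InnerProductSpace ℝ E]

/-- The rotation `(x, y) ↦ (x cos θ + y sin θ, -x sin θ + y cos θ)` as a linear isometry. -/
def pairRotationIsometry (E : Type*) [NormedAddCommGroup E] [InnerProductSpace ℝ E] (θ : ℝ) :
    WithLp 2 (E × E) →ₗᵢ[ℝ] WithLp 2 (E × E) where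
  toFun z := WithLp.toLp 2 (Real.cos θ • z.fst + Real.sin θ • z.snd,
    -Real.sin θ • z.fst + Real.cos θ • z.snd)
  map_add' z w := by
    apply WithLp.ofLp_injective
    ext <;> simp <;> abel
  map_smul' c z := by
    apply WithLp.ofLp_injective
    ext <;> simp [smul_comm c]
  norm_map' z := by
    refine (sq_eq_sq₀ (norm_nonneg _) (norm_nonneg _)).1 ?_
    simp only [LinearMap.coe_mk, AddHom.coe_mk, WithLp.prod_norm_sq_eq_of_L2, WithLp.toLp_fst,
      WithLp.toLp_snd, norm_add_sq_real, norm_smul, real_inner_smul_left, real_inner_smul_right,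
      mul_pow, norm_neg, Real.norm_eq_abs, sq_abs]
    linear_combination (‖z.fst‖ ^ 2 + ‖z.snd‖ ^ 2) * Real.cos_sq_add_sin_sq θ

/-- The rotation `(x, y) ↦ (x cos θ + y sin θ, -x sin θ + y cos θ)`. -/
def pairRotation (E : Type*) [NormedAddCommGroup E] [InnerProductSpace ℝ E]
    [FiniteDimensional ℝ E] (θ : ℝ) : WithLp 2 (E × E) ≃ₗᵢ[ℝ] WithLp 2 (E × E) :=
  (pairRotationIsometry E θ).toLinearIsometryEquiv rfl

theorem pairRotation_fst [FiniteDimensional ℝ E] (θ : ℝ) (z : WithLp 2 (E × E)) :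
    (pairRotation E θ z).fst = Real.cos θ • z.fst + Real.sin θ • z.snd := rfl

theorem pairRotation_snd [FiniteDimensional ℝ E] (θ : ℝ) (z : WithLp 2 (E × E)) :
    (pairRotation E θ z).snd = -Real.sin θ • z.fst + Real.cos θ • z.snd := rfl

theorem pairRotation_add_fst [FiniteDimensional ℝ E] (s t : ℝ) (z : WithLp 2 (E × E)) :
    (pairRotation E (s + t) z).fst = (pairRotation E t (pairRotation E s z)).fst := by
  simp only [pairRotation_fst, pairRotation_snd, Real.cos_add, Real.sin_add]
  module

/-- The dominating function for the limit `N → ∞`: a rotation by `θ / N` displaces the first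
component by `O(|θ| ‖z‖ / N)`, so the factor `N` cancels. -/
theorem enorm_difference_quotient_pairRotation_le [FiniteDimensional ℝ E] {C : ℝ≥0} {f : E → ℝ} (hf : LipschitzWith C f)
    (z : WithLp 2 (E × E)) (θ : ℝ) (N : ℕ) :
    ‖(N : ℝ) * (f (pairRotation E (θ / N) z).fst - f z.fst)‖ₑ ≤
      ENNReal.ofReal (2 * C * |θ|) * ‖z‖ₑ := by
  rw [← ofReal_norm, ← ofReal_norm, ← ENNReal.ofReal_mul (by positivity)]
  refine ENNReal.ofReal_le_ofReal ?_
  rcases Nat.eq_zero_or_pos N with rfl | hN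
  · simp; positivity
  have hN : (0 : ℝ) < N := Nat.cast_pos.2 hN
  have h1 : ‖f (pairRotation E (θ / N) z).fst - f z.fst‖ ≤
      C * ‖(pairRotation E (θ / N) z).fst - z.fst‖ := hf.norm_sub_le _ _
  have h2 : ‖(pairRotation E (θ / N) z).fst - z.fst‖ ≤ |θ / N| * ‖z.fst‖ + |θ / N| * ‖z.snd‖ := by
    rw [pairRotation_fst, show Real.cos (θ / N) • z.fst + Real.sin (θ / N) • z.snd - z.fst =
      (Real.cos (θ / N) - 1) • z.fst + Real.sin (θ / N) • z.snd by module]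
    refine (norm_add_le _ _).trans ?_
    rw [norm_smul, norm_smul]
    gcongr
    · simpa using Real.abs_cos_sub_cos_le (θ / N) 0
    · simpa using Real.abs_sin_sub_sin_le (θ / N) 0
  have h3 : ‖z.fst‖ ≤ ‖z‖ := WithLp.norm_fst_le _ z
  have h4 : ‖z.snd‖ ≤ ‖z‖ := WithLp.norm_snd_le _ z
  have h5 : |θ / N| = |θ| / N := by rw [abs_div, abs_of_pos hN]
  rw [norm_mul, Real.norm_of_nonneg hN.le]
  calc (N : ℝ) * ‖f (pairRotation E (θ / N) z).fst - f z.fst‖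
      ≤ N * (C * (|θ / N| * ‖z‖ + |θ / N| * ‖z‖)) := by
        gcongr
        exact h1.trans (by gcongr; exact h2.trans (by gcongr))
    _ = 2 * C * |θ| * ‖z‖ := by rw [h5]; field_simp; ring

theorem tendsto_difference_quotient_pairRotation [FiniteDimensional ℝ E] {f : E → ℝ} (z : WithLp 2 (E × E))
    (hf : DifferentiableAt ℝ f z.fst) (θ : ℝ) :
    Tendsto (fun N : ℕ => (N : ℝ) * (f (pairRotation E (θ / N) z).fst - f z.fst)) atTop
      (𝓝 (θ * fderiv ℝ f z.fst z.snd)) := by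
  have h1 : HasDerivAt (fun t : ℝ => (pairRotation E t z).fst) z.snd 0 := by
    simp only [pairRotation_fst]
    simpa using! ((Real.hasDerivAt_cos 0).smul_const z.fst).add
      ((Real.hasDerivAt_sin 0).smul_const z.snd)
  have h0 : (pairRotation E 0 z).fst = z.fst := by simp [pairRotation_fst]
  have h2 : HasDerivAt (fun t : ℝ => f (pairRotation E t z).fst) (fderiv ℝ f z.fst z.snd) 0 := by
    have h3 := hf.hasFDerivAt
    rw [← h0] at h3
    simpa only [h0] using! h3.comp_hasDerivAt 0 h1
  have h4 := (h2.hasFDerivAt.lim θ (c := fun N : ℕ => (N : ℝ)) (l := atTop)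
    (by simpa using tendsto_natCast_atTop_atTop (R := ℝ)))
  simpa [h0, div_eq_inv_mul] using h4

variable [FiniteDimensional ℝ E] [MeasurableSpace E] [BorelSpace E]

theorem measurable_withLp_fst : Measurable fun z : WithLp 2 (E × E) => z.fst :=
  (WithLp.continuous_fst 2 E E).measurable

theorem measurable_withLp_snd : Measurable fun z : WithLp 2 (E × E) => z.snd :=
  (WithLp.continuous_snd 2 E E).measurable

/-- Telescoping: by rotation invariance each of the `N` increments has the same L¹ norm as the
first. -/
theorem lintegral_enorm_sub_pairRotation_nat_mul_le (a h : ℝ) {f : E → ℝ} (hf : Measurable f)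
    (N : ℕ) :
    ∫⁻ z, ‖f (pairRotation E (N * h) z).fst - f z.fst‖ₑ
        ∂(multivariateCauchy (WithLp 2 (E × E)) a) ≤
      N * ∫⁻ z, ‖f (pairRotation E h z).fst - f z.fst‖ₑ
        ∂(multivariateCauchy (WithLp 2 (E × E)) a) := by
  have hm : ∀ t, Measurable fun z : WithLp 2 (E × E) => f (pairRotation E t z).fst := fun t =>
    (hf.comp measurable_withLp_fst).comp (pairRotation E t).continuous.measurable
  have hm0 : Measurable fun z : WithLp 2 (E × E) => f z.fst := hf.comp measurable_withLp_fst
  induction N with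
  | zero => simp [pairRotation_fst]
  | succ N ih =>
    calc
      _ ≤ ∫⁻ z, (‖f (pairRotation E (N * h) z).fst - f z.fst‖ₑ +
          ‖f (pairRotation E h (pairRotation E (N * h) z)).fst -
            f (pairRotation E (N * h) z).fst‖ₑ) ∂(multivariateCauchy (WithLp 2 (E × E)) a) := by
        refine lintegral_mono fun z => ?_
        rw [show ((N + 1 : ℕ) : ℝ) * h = N * h + h by push_cast; ring, pairRotation_add_fst]
        refine le_trans (le_of_eq ?_) (enorm_add_le _ _)
        congr 1
        ring
      _ ≤ _ := by
        rw [lintegral_add_left (by exact ((hm _).sub hm0).enorm),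
          lintegral_multivariateCauchy_comp a (pairRotation E (N * h))
            (g := fun z => ‖f (pairRotation E h z).fst - f z.fst‖ₑ) (((hm _).sub hm0).enorm)]
        push_cast
        rw [add_mul, one_mul]
        gcongr

/-- Rademacher's theorem, pulled back along the first projection and passed to an absolutely
continuous measure. -/
theorem ae_differentiableAt_fst {C : ℝ≥0} {f : E → ℝ} (hf : LipschitzWith C f) (a : ℝ) :
    ∀ᵐ z ∂(multivariateCauchy (WithLp 2 (E × E)) a), DifferentiableAt ℝ f z.fst := by
  have h1 : ∀ᵐ x : E, DifferentiableAt ℝ f x := hf.ae_differentiableAt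
  have h2 : ∀ᵐ z : WithLp 2 (E × E), DifferentiableAt ℝ f z.fst :=
    (Measure.quasiMeasurePreserving_fst.comp
      (WithLp.volume_preserving_ofLp E E).quasiMeasurePreserving).ae h1
  exact (withDensity_absolutelyContinuous _ _).ae_le h2

/-- Pisier's inequality for the Cauchy measure on `E × E`. -/
theorem lintegral_enorm_sub_le_lintegral_fderiv {C : ℝ≥0} {f : E → ℝ} (hf : LipschitzWith C f)
    {a : ℝ} (ha : (Module.finrank ℝ E : ℝ) + 1 / 2 < a) :
    ∫⁻ z, ‖f z.snd - f z.fst‖ₑ ∂(multivariateCauchy (WithLp 2 (E × E)) a) ≤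
      ENNReal.ofReal (Real.pi / 2) * ∫⁻ z, ‖fderiv ℝ f z.fst z.snd‖ₑ
        ∂(multivariateCauchy (WithLp 2 (E × E)) a) := by
  have hdim : (Module.finrank ℝ (WithLp 2 (E × E)) : ℝ) = 2 * Module.finrank ℝ E := by
    rw [(WithLp.linearEquiv 2 ℝ (E × E)).finrank_eq, Module.finrank_prod]; push_cast; ring
  have hfm := hf.continuous.measurable
  have hm : ∀ t, Measurable fun z : WithLp 2 (E × E) => f (pairRotation E t z).fst := fun t =>
    (hfm.comp measurable_withLp_fst).comp (pairRotation E t).continuous.measurable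
  have hm0 : Measurable fun z : WithLp 2 (E × E) => f z.fst := hfm.comp measurable_withLp_fst
  have hlim : Tendsto (fun N : ℕ =>
      ∫⁻ z, ‖(N : ℝ) * (f (pairRotation E (Real.pi / 2 / N) z).fst - f z.fst)‖ₑ
        ∂(multivariateCauchy (WithLp 2 (E × E)) a)) atTop
      (𝓝 (∫⁻ z, ‖Real.pi / 2 * fderiv ℝ f z.fst z.snd‖ₑ
        ∂(multivariateCauchy (WithLp 2 (E × E)) a))) := by
    refine tendsto_lintegral_of_dominated_convergence
      (fun z => ENNReal.ofReal (2 * C * |Real.pi / 2|) * ‖z‖ₑ)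
      (fun N => (((hm _).sub hm0).const_mul _).enorm)
      (fun N => .of_forall fun z => enorm_difference_quotient_pairRotation_le hf z _ N) ?_ ?_
    · rw [lintegral_const_mul' _ _ ENNReal.ofReal_ne_top]
      exact ENNReal.mul_ne_top ENNReal.ofReal_ne_top
        (lintegral_enorm_multivariateCauchy_ne_top (by rw [hdim]; linarith))
    · filter_upwards [ae_differentiableAt_fst hf a] with z hz
      exact (tendsto_difference_quotient_pairRotation z hz _).enorm
  have heq : ∫⁻ z, ‖Real.pi / 2 * fderiv ℝ f z.fst z.snd‖ₑ
        ∂(multivariateCauchy (WithLp 2 (E × E)) a) = ENNReal.ofReal (Real.pi / 2) *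
      ∫⁻ z, ‖fderiv ℝ f z.fst z.snd‖ₑ ∂(multivariateCauchy (WithLp 2 (E × E)) a) := by
    rw [← lintegral_const_mul' _ _ ENNReal.ofReal_ne_top]
    refine lintegral_congr fun z => ?_
    rw [enorm_mul, Real.enorm_of_nonneg (by positivity : 0 ≤ Real.pi / 2)]
  rw [← heq]
  refine ge_of_tendsto hlim ?_
  filter_upwards [eventually_gt_atTop 0] with N hN
  have hN' : (N : ℝ) ≠ 0 := Nat.cast_ne_zero.2 hN.ne'
  -- The `N` rotations compose to the quarter turn, whose first component is `z.snd`.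
  have h := lintegral_enorm_sub_pairRotation_nat_mul_le a (Real.pi / 2 / N) hfm N
  rw [mul_div_cancel₀ _ hN'] at h
  simp_rw [enorm_mul, show ‖(N : ℝ)‖ₑ = (N : ℝ≥0∞) by simp]
  rw [lintegral_const_mul' _ _ (ENNReal.natCast_ne_top N)]
  simpa [pairRotation_fst] using h

/-! ### Integrating out the second variable. -/

/-- For fixed `x`, `y ↦ fderiv ℝ f x y` is a linear form integrated against `(r + ‖y‖²)^(-a)` with
`r = 1 + ‖x‖²`. This yields its norm times a power of `r` whose order has dropped by `(d + 1) / 2`;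
the constant collects the two normalizations. -/
theorem lintegral_fderiv_multivariateCauchy_eq (f : E → ℝ) {a : ℝ}
    (ha : (Module.finrank ℝ E : ℝ) + 1 / 2 < a) :
    ∫⁻ z, ‖fderiv ℝ f z.fst z.snd‖ₑ ∂(multivariateCauchy (WithLp 2 (E × E)) a) =
      ENNReal.ofReal (Real.Gamma (a - Module.finrank ℝ E - 1 / 2) /
          Real.Gamma (a - Module.finrank ℝ E) / √Real.pi) *
        ∫⁻ x, ‖fderiv ℝ f x‖ₑ
          ∂(multivariateCauchy E (a - ((Module.finrank ℝ E : ℝ) + 1) / 2)) := by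
  have hdim : (Module.finrank ℝ (WithLp 2 (E × E)) : ℝ) = 2 * Module.finrank ℝ E := by
    rw [(WithLp.linearEquiv 2 ℝ (E × E)).finrank_eq, Module.finrank_prod]; push_cast; ring
  have hDm : Measurable fun p : E × E => ‖fderiv ℝ f p.1 p.2‖ₑ := by
    have h1 : Measurable fun p : (E →L[ℝ] ℝ) × E => p.1 p.2 :=
      isBoundedBilinearMap_apply.continuous.measurable
    exact (h1.comp (((measurable_fderiv ℝ f).comp measurable_fst).prodMk measurable_snd)).enorm
  set d : ℝ := (Module.finrank ℝ E : ℝ) with hd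
  have hd0 : 0 ≤ d := Nat.cast_nonneg _
  set b := a - (d + 1) / 2 with hb
  have hm : Measurable fun z : WithLp 2 (E × E) => ‖fderiv ℝ f z.fst z.snd‖ₑ :=
    hDm.comp (WithLp.volume_preserving_ofLp E E).measurable
  rw [lintegral_multivariateCauchy a hm,
    lintegral_multivariateCauchy b (measurable_fderiv ℝ f).enorm]
  have h1 : ∫⁻ z : WithLp 2 (E × E), ‖fderiv ℝ f z.fst z.snd‖ₑ *
      ENNReal.ofReal ((1 + ‖z‖ ^ 2) ^ (-a)) = ∫⁻ x : E, ∫⁻ y : E, ‖fderiv ℝ f x y‖ₑ *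
        ENNReal.ofReal ((1 + ‖x‖ ^ 2 + ‖y‖ ^ 2) ^ (-a)) := by
    have hmm : Measurable fun p : E × E => ‖fderiv ℝ f p.1 p.2‖ₑ *
      ENNReal.ofReal ((1 + ‖p.1‖ ^ 2 + ‖p.2‖ ^ 2) ^ (-a)) := hDm.mul (by fun_prop)
    rw [← lintegral_prod (fun p : E × E => ‖fderiv ℝ f p.1 p.2‖ₑ *
      ENNReal.ofReal ((1 + ‖p.1‖ ^ 2 + ‖p.2‖ ^ 2) ^ (-a))) hmm.aemeasurable,
      ← Measure.volume_eq_prod, ← (WithLp.volume_preserving_ofLp E E).lintegral_comp hmm]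
    refine lintegral_congr fun z => ?_
    rw [WithLp.prod_norm_sq_eq_of_L2, add_assoc]
    rfl
  have h2 : ∀ x : E, ∫⁻ y : E, ‖fderiv ℝ f x y‖ₑ *
        ENNReal.ofReal ((1 + ‖x‖ ^ 2 + ‖y‖ ^ 2) ^ (-a)) =
      ENNReal.ofReal (Real.pi ^ ((d - 1) / 2) * (Real.Gamma b / Real.Gamma a)) *
        (‖fderiv ℝ f x‖ₑ * ENNReal.ofReal ((1 + ‖x‖ ^ 2) ^ (-b))) := by
    intro x
    have hx : 0 < 1 + ‖x‖ ^ 2 := by positivity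
    rw [lintegral_clm_mul_rpow_neg_add_norm_sq _ hx (by linarith),
      ENNReal.ofReal_mul' (by positivity), mul_left_comm]
  have hΓa := Real.Gamma_pos_of_pos (show 0 < a by linarith)
  have hΓb := Real.Gamma_pos_of_pos (show 0 < b by linarith)
  have hΓ1 := Real.Gamma_pos_of_pos (show 0 < a - d by linarith)
  have hΓ2 := Real.Gamma_pos_of_pos (show 0 < a - d - 1 / 2 by linarith)
  have hc1 : cauchyNormConst (WithLp 2 (E × E)) a =
      Real.pi ^ d * (Real.Gamma (a - d) / Real.Gamma a) := by
    rw [cauchyNormConst_eq (by linarith) (by rw [hdim]; linarith), hdim]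
    congr 2 <;> ring_nf
  have hc2 : cauchyNormConst E b =
      Real.pi ^ (d / 2) * (Real.Gamma (a - d - 1 / 2) / Real.Gamma b) := by
    rw [cauchyNormConst_eq (by linarith) (by linarith), ← hd]
    congr 3
    rw [hb]; ring
  rw [h1]
  simp_rw [h2]
  rw [lintegral_const_mul' _ _ ENNReal.ofReal_ne_top, ← mul_assoc, ← mul_assoc,
    ← ENNReal.ofReal_mul (by rw [hc1]; positivity), ← ENNReal.ofReal_mul (by positivity)]
  congr 2
  have hp : Real.pi ^ d = Real.pi ^ ((d - 1) / 2) * Real.pi ^ (d / 2) * √Real.pi := by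
    rw [Real.sqrt_eq_rpow, ← Real.rpow_add Real.pi_pos, ← Real.rpow_add Real.pi_pos]
    congr 1; ring
  have hs : 0 < √Real.pi := Real.sqrt_pos.2 Real.pi_pos
  have hp1 : 0 < Real.pi ^ ((d - 1) / 2) := Real.rpow_pos_of_pos Real.pi_pos _
  have hp2 : 0 < Real.pi ^ (d / 2) := Real.rpow_pos_of_pos Real.pi_pos _
  rw [hc1, hc2, hp]
  generalize Real.Gamma (a - d - 1 / 2) = G at *
  field_simp

/-! ### From functions to sets, and the limit `ε → 0`. -/

/-- The integrand equals 1 on `A × (A_ε)ᶜ` and on its mirror image. These are disjoint and, the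
measure being invariant under swapping factors, have equal mass; hence the 2. -/
theorem two_mul_multivariateCauchy_prod_le (a : ℝ) {ε : ℝ} (hε : 0 < ε) {A : Set E}
    (hA : MeasurableSet A) :
    2 * multivariateCauchy (WithLp 2 (E × E)) a
        (WithLp.ofLp ⁻¹' (A ×ˢ (Metric.thickening ε A)ᶜ)) ≤
      ∫⁻ z, ‖(thickenedIndicator hε A z.snd : ℝ) - thickenedIndicator hε A z.fst‖ₑ
        ∂(multivariateCauchy (WithLp 2 (E × E)) a) := by
  have hofLp := (WithLp.volume_preserving_ofLp E E).measurable
  have hB : MeasurableSet (Metric.thickening ε A)ᶜ :=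
    Metric.isOpen_thickening.measurableSet.compl
  set S : Set (WithLp 2 (E × E)) := WithLp.ofLp ⁻¹' (A ×ˢ (Metric.thickening ε A)ᶜ) with hS
  set S' : Set (WithLp 2 (E × E)) := WithLp.ofLp ⁻¹' ((Metric.thickening ε A)ᶜ ×ˢ A) with hS'
  have hSm : MeasurableSet S := hofLp (hA.prod hB)
  have hSm' : MeasurableSet S' := hofLp (hB.prod hA)
  have hsub := Metric.self_subset_thickening hε A
  have hdisj : Disjoint S S' :=
    Set.disjoint_left.2 fun z hz hz' => hz'.1 (hsub hz.1)
  have hswap : multivariateCauchy (WithLp 2 (E × E)) a S' =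
      multivariateCauchy (WithLp 2 (E × E)) a S := by
    have h := lintegral_multivariateCauchy_comp a (LinearIsometryEquiv.withLpProdComm 2 ℝ E E)
      (g := S.indicator 1) (measurable_one.indicator hSm)
    rw [lintegral_indicator_one hSm] at h
    rw [← h, ← lintegral_indicator_one hSm']
    refine lintegral_congr fun z => ?_
    have hz : LinearIsometryEquiv.withLpProdComm 2 ℝ E E z ∈ S ↔ z ∈ S' := and_comm
    by_cases hz' : z ∈ S'
    · rw [Set.indicator_of_mem hz', Set.indicator_of_mem (hz.2 hz')]
      rfl
    · rw [Set.indicator_of_notMem hz', Set.indicator_of_notMem (hz.not.2 hz')]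
  rw [two_mul]
  nth_rw 2 [← hswap]
  rw [← measure_union hdisj hSm', ← lintegral_indicator_one (hSm.union hSm')]
  refine lintegral_mono fun z => ?_
  by_cases hz : z ∈ S ∪ S'
  · rw [Set.indicator_of_mem hz]
    rcases hz with hz | hz
    · rw [thickenedIndicator_zero hε A (x := z.snd) hz.2,
        thickenedIndicator_one hε A (x := z.fst) hz.1]
      simp
    · rw [thickenedIndicator_zero hε A (x := z.fst) hz.1,
        thickenedIndicator_one hε A (x := z.snd) hz.2]
      simp
  · rw [Set.indicator_of_notMem hz]
    exact zero_le

theorem mul_multivariateCauchy_prod_compl_thickening_le {a : ℝ}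
    (ha : (Module.finrank ℝ E : ℝ) + 1 ≤ a) {ε : ℝ} (hε : 0 < ε) {A : Set E}
    (hA : MeasurableSet A) :
    ENNReal.ofReal (2 * √(a - Module.finrank ℝ E) / √Real.pi) *
        multivariateCauchy (WithLp 2 (E × E)) a
          (WithLp.ofLp ⁻¹' (A ×ˢ (Metric.thickening ε A)ᶜ)) ≤
      multivariateCauchy E (a - ((Module.finrank ℝ E : ℝ) + 1) / 2) (Metric.thickening ε A \ A) /
        ENNReal.ofReal ε := by
  have hL : LipschitzWith ε.toNNReal⁻¹ (fun y => (thickenedIndicator hε A y : ℝ)) :=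
    lipschitzWith_thickenedIndicator hε A
  have h1 := lintegral_enorm_sub_le_lintegral_fderiv hL (show _ < a by linarith)
  rw [lintegral_fderiv_multivariateCauchy_eq _ (by linarith), ← mul_assoc,
    ← ENNReal.ofReal_mul (by positivity)] at h1
  have h2 := (two_mul_multivariateCauchy_prod_le a hε hA).trans (h1.trans (mul_le_mul_right
    (lintegral_fderiv_thickenedIndicator_le _ hε hA) _))
  set d : ℝ := (Module.finrank ℝ E : ℝ)
  set Q := multivariateCauchy E (a - (d + 1) / 2) (Metric.thickening ε A \ A) / ENNReal.ofReal ε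
  have hs : 0 < √(a - d) := Real.sqrt_pos.2 (by linarith)
  have hp : 0 < √Real.pi := Real.sqrt_pos.2 Real.pi_pos
  have hp2 : √Real.pi * √Real.pi = Real.pi := Real.mul_self_sqrt Real.pi_pos.le
  have hΓ := Gamma_sub_half_div_Gamma_le (a := a - d) (by linarith)
  -- `π / 2` comes from the quarter turn; the bound `2 / √(a - d)` on the Gamma ratio makes the
  -- product collapse to exactly 1.
  have hconst : √(a - d) / √Real.pi * (Real.pi / 2 *
      (Real.Gamma (a - d - 1 / 2) / Real.Gamma (a - d) / √Real.pi)) ≤ 1 := by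
    calc _ ≤ √(a - d) / √Real.pi * (Real.pi / 2 * (2 / √(a - d) / √Real.pi)) := by gcongr
      _ = 1 := by field_simp; nlinarith
  calc ENNReal.ofReal (2 * √(a - d) / √Real.pi) * _
      = ENNReal.ofReal (√(a - d) / √Real.pi) * (2 * _) := by
        rw [mul_div_assoc, ENNReal.ofReal_mul (by norm_num), ENNReal.ofReal_ofNat]; ring
    _ ≤ ENNReal.ofReal (√(a - d) / √Real.pi) * _ := mul_le_mul_right h2 _
    _ ≤ 1 * Q := by
        rw [← mul_assoc, ← ENNReal.ofReal_mul (by positivity)]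
        gcongr
        exact ENNReal.ofReal_le_one.2 hconst
    _ = Q := one_mul Q

theorem tendsto_measure_prod_compl_thickening (μ : Measure (WithLp 2 (E × E))) [IsFiniteMeasure μ]
    {A : Set E} (hA : IsClosed A) :
    Tendsto (fun ε => μ (WithLp.ofLp ⁻¹' (A ×ˢ (Metric.thickening ε A)ᶜ))) (𝓝[>] 0)
      (𝓝 (μ (WithLp.ofLp ⁻¹' (A ×ˢ Aᶜ)))) := by
  -- With `A` fixed as first factor, the mass is a finite measure in the second factor, so
  -- continuity along `A_ε ↓ A` applies.
  let ν : Measure E := (μ.restrict (WithLp.fst ⁻¹' A)).map WithLp.snd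
  have hν : ∀ B, MeasurableSet B → ν B = μ (WithLp.ofLp ⁻¹' (A ×ˢ B)) := by
    intro B hB
    rw [Measure.map_apply measurable_withLp_snd hB,
      Measure.restrict_apply (measurable_withLp_snd hB), Set.inter_comm]
    rfl
  have hT : ∀ ε, MeasurableSet (Metric.thickening ε A) := fun ε =>
    Metric.isOpen_thickening.measurableSet
  simp_rw [← hν _ hA.measurableSet.compl, ← hν _ (hT _).compl,
    measure_compl hA.measurableSet (measure_ne_top ν _), measure_compl (hT _) (measure_ne_top ν _)]
  exact ENNReal.Tendsto.sub tendsto_const_nhds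
    (tendsto_measure_thickening_of_isClosed ⟨1, one_pos, measure_ne_top ν _⟩ hA)
    (.inl (measure_ne_top ν _))

theorem mul_multivariateCauchy_prod_compl_le_outerMinkowskiContent {a : ℝ}
    (ha : (Module.finrank ℝ E : ℝ) + 1 ≤ a) {A : Set E} (hA : IsClosed A) :
    ENNReal.ofReal (2 * √(a - Module.finrank ℝ E) / √Real.pi) *
        multivariateCauchy (WithLp 2 (E × E)) a (WithLp.ofLp ⁻¹' (A ×ˢ Aᶜ)) ≤
      outerMinkowskiContent
        (multivariateCauchy E (a - ((Module.finrank ℝ E : ℝ) + 1) / 2)) A := by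
  have hd : (0 : ℝ) ≤ Module.finrank ℝ E := Nat.cast_nonneg _
  have hdim : (Module.finrank ℝ (WithLp 2 (E × E)) : ℝ) = 2 * Module.finrank ℝ E := by
    rw [(WithLp.linearEquiv 2 ℝ (E × E)).finrank_eq, Module.finrank_prod]; push_cast; ring
  have := isProbabilityMeasure_multivariateCauchy (E := WithLp 2 (E × E)) (a := a)
    (by linarith) (by rw [hdim]; linarith)
  have := isProbabilityMeasure_multivariateCauchy (E := E)
    (a := a - ((Module.finrank ℝ E : ℝ) + 1) / 2) (by linarith) (by linarith)
  -- The left side is the limit of its `ε`-versions, hence their liminf, so the bound for each `ε`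
  -- passes to the liminf.
  rw [outerMinkowskiContent, ← (ENNReal.Tendsto.const_mul
    (tendsto_measure_prod_compl_thickening (multivariateCauchy (WithLp 2 (E × E)) a) hA)
    (.inr ENNReal.ofReal_ne_top)).liminf_eq]
  refine liminf_le_liminf ?_
  filter_upwards [self_mem_nhdsWithin] with ε hε
  rw [← measure_sdiff (Metric.self_subset_thickening hε A) hA.measurableSet.nullMeasurableSet
    (measure_ne_top _ _)]
  exact mul_multivariateCauchy_prod_compl_thickening_le ha hε hA.measurableSet

end

/-- `WithLp 2 (ℝⁿ × ℝⁿ)` is `ℝⁿ × ℝⁿ` with the Euclidean norm, `|(x, y)|² = |x|² + |y|²`; the set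
in the last line is `A × Aᶜ`. -/
theorem corollary9p1 (n : ℕ) (α β : ℝ) (hα : (n : ℝ) + 1 ≤ α)
    (hβ : β = α - ((n : ℝ) + 1) / 2)
    (A : Set (EuclideanSpace ℝ (Fin n))) (hA : IsClosed A) :
    ENNReal.ofReal (2 * √(α - n) / √Real.pi) *
        multivariateCauchy
          (WithLp 2 (EuclideanSpace ℝ (Fin n) × EuclideanSpace ℝ (Fin n))) α
          (WithLp.ofLp ⁻¹' (A ×ˢ Aᶜ))
      ≤ outerMinkowskiContent (multivariateCauchy (EuclideanSpace ℝ (Fin n)) β) A := by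
  have h := mul_multivariateCauchy_prod_compl_le_outerMinkowskiContent
    (E := EuclideanSpace ℝ (Fin n)) (a := α) (by simpa using hα) hA
  simpa only [finrank_euclideanSpace_fin, ← hβ] using h
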